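/- Let $(R,\mathfrak m)$ be a commutative noetherian local ring, let $I,J$ be ideals of $R$, not both equal to $R$, and let $M$ be a finitely generated $R$-module. Put $$W(I,J)=\{\mathfrak p\in\operatorname{Spec}R \mid I^n\subseteq \mathfrak p+J\text{ for some }n\ge 1\},$$ and for an $R$-module $N$ let $\Gamma_{I,J}(N)$ be the submodule of all $x\in N$ with $\operatorname{Supp}(Rx)\subseteq W(I,J)$. Let $H^i_{I,J}$ denote the $i$-th right derived functor of $\Gamma_{I,J}$. An $R$-module $N$ is called $I$-cofinite if $\operatorname{Supp}N\subseteq V(I)$ and $\operatorname{Ext}^j_R(R/I,N)$ is a finitely generated $R$-module for all $j\ge 0$. Let $t\ge 1$ be an integer such that $\operatorname{Supp}H^i_{I,J}(M)\subseteq\{\mathfrak m\}$ for all $i<t$. Then for all $i<t$ the $R$-module $H^i_{I,J}(M)$ is artinian and $I$-cofinite. -/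

import Mathlib

open CategoryTheory

universe u

namespace PairLocalCohomology

/-- `W(I, J)`: the primes `p` with `I ^ n ⊆ p + J` for some `n ≥ 1`. -/
def W {R : Type u} [CommRing R] (I J : Ideal R) : Set (PrimeSpectrum R) :=
  {p | ∃ n : ℕ, 1 ≤ n ∧ I ^ n ≤ p.asIdeal ⊔ J}

/-- The `(I, J)`-torsion submodule `Γ_{I,J}(M)`: the elements `x` with `Supp (R x) ⊆ W(I, J)`. -/
def torsion {R : Type u} [CommRing R] (I J : Ideal R) (M : Type u) [AddCommGroup M]
    [Module R M] : Submodule R M where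
  carrier := {x | Module.support R (Submodule.span R {x}) ⊆ W I J}
  zero_mem' := by
    intro p hp
    rw [Module.mem_support_iff'] at hp
    obtain ⟨⟨m, hm⟩, hp⟩ := hp
    obtain ⟨a, rfl⟩ := Submodule.mem_span_singleton.1 hm
    exact absurd (Subtype.ext (by simp)) (hp 1 p.asIdeal.primeCompl.one_mem)
  add_mem' := by
    intro x y hx hy p hp
    by_contra hW
    have h1 : p ∉ Module.support R (Submodule.span R {x}) := fun h => hW (hx h)
    have h2 : p ∉ Module.support R (Submodule.span R {y}) := fun h => hW (hy h)
    rw [Module.notMem_support_iff'] at h1 h2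
    rw [Module.mem_support_iff'] at hp
    obtain ⟨⟨m, hm⟩, hp⟩ := hp
    obtain ⟨a, rfl⟩ := Submodule.mem_span_singleton.1 hm
    obtain ⟨r, hr, hrx⟩ := h1 ⟨x, Submodule.mem_span_singleton_self x⟩
    obtain ⟨s, hs, hsy⟩ := h2 ⟨y, Submodule.mem_span_singleton_self y⟩
    have hrx' : r • x = 0 := congrArg Subtype.val hrx
    have hsy' : s • y = 0 := congrArg Subtype.val hsy
    refine hp (r * s) (p.asIdeal.primeCompl.mul_mem hr hs) (Subtype.ext ?_)
    change (r * s) • a • (x + y) = 0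
    have e : (r * s) • a • (x + y) = (s * a) • (r • x) + (r * a) • (s • y) := by
      module
    rw [e, hrx', hsy', smul_zero, smul_zero, add_zero]
  smul_mem' := by
    intro c x hx
    refine (Module.support_subset_of_injective
      (Submodule.inclusion (Submodule.span_singleton_smul_le R c x))
      (Submodule.inclusion_injective _)).trans hx

/-- A linear map sends `(I, J)`-torsion elements to `(I, J)`-torsion elements. -/
theorem map_mem_torsion {R : Type u} [CommRing R] (I J : Ideal R) {M N : Type u}
    [AddCommGroup M] [Module R M] [AddCommGroup N] [Module R N] (f : M →ₗ[R] N) {x : M}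
    (hx : x ∈ torsion I J M) : f x ∈ torsion I J N := by
  intro p hp
  apply hx
  by_contra h
  rw [Module.notMem_support_iff'] at h
  rw [Module.mem_support_iff'] at hp
  obtain ⟨⟨m, hm⟩, hp⟩ := hp
  obtain ⟨a, rfl⟩ := Submodule.mem_span_singleton.1 hm
  obtain ⟨r, hr, hrx⟩ := h ⟨x, Submodule.mem_span_singleton_self x⟩
  have hrx' : r • x = 0 := congrArg Subtype.val hrx
  refine hp r hr (Subtype.ext ?_)
  change r • a • f x = 0
  rw [smul_comm, ← map_smul, hrx', map_zero, smul_zero]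

/-- The `(I, J)`-torsion functor `Γ_{I,J}`, acting on morphisms by restriction. -/
def torsionFunctor {R : Type u} [CommRing R] (I J : Ideal R) :
    ModuleCat.{u} R ⥤ ModuleCat.{u} R where
  obj M := ModuleCat.of R (torsion I J M)
  map {M N} f := ModuleCat.ofHom
    (f.hom.restrict (p := torsion I J M) (q := torsion I J N) fun _ => map_mem_torsion I J f.hom)
  map_id _ := rfl
  map_comp _ _ := rfl

instance torsionFunctor_additive {R : Type u} [CommRing R] (I J : Ideal R) :
    (torsionFunctor I J).Additive where
  map_add := rfl

/-- The local cohomology module `H^i_{I,J}(M)`: the `i`-th right derived functor of `Γ_{I,J}`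
evaluated at `M`. -/
noncomputable def localCohomology {R : Type u} [CommRing R] (I J : Ideal R) (i : ℕ)
    (M : Type u) [AddCommGroup M] [Module R M] : ModuleCat.{u} R :=
  ((torsionFunctor I J).rightDerived i).obj (ModuleCat.of R M)

/-- `N` is `I`-cofinite: `Supp N ⊆ V(I)` and `Ext^j_R(R/I, N)` is finitely generated for all
`j ≥ 0`. -/
def IsCofinite {R : Type u} [CommRing R] (I : Ideal R) (N : ModuleCat.{u} R) : Prop :=
  Module.support R N ⊆ PrimeSpectrum.zeroLocus (I : Set R) ∧
    ∀ j : ℕ, Module.Finite R (Abelian.Ext (ModuleCat.of R (R ⧸ I)) N j)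

end PairLocalCohomology

/-!
# Artinianness and cofiniteness of local cohomology supported at the closed point

The argument is an induction on the cohomological degree `i`, carried out on the complex
`G = Γ_{I,J}(A)` for an injective resolution `A` of `M`. It rests on two independent facts.

* If `H^j_{I,J}(M)` is `I`-cofinite for all `j < i`, then `(0 : I)` in `H^i_{I,J}(M)` is finitely
  generated (`isNoetherian_torsionBySet_localCohomology`). The complex `G` consists of injective
  modules (`injective_torsion`), so dimension shifting along cocycles and coboundaries shows that
  `Ext^1(R/I, B^i(G))` is finitely generated (`finite_ext_boundaries`); this bounds the cokernel of
  `Hom(R/I, Z^i(G)) → Hom(R/I, H^i(G))`. Since `G` contains every element of `A` killed by `I`, the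
  image of that map is a subquotient of `Ext^1(R/I, Z^(i-1)(A))`, which is finitely generated by the
  same dimension shifting applied to `A`, because `M` is finitely generated.

* If `N` is supported at the maximal ideal and `(0 :_N I)` is finitely generated for a proper ideal
  `I`, then `N` is artinian (`isArtinian_of_isNoetherian_torsionBySet`, a criterion of Melkersson)
  and `I`-cofinite (`finite_ext_of_isArtinian`). For the second point, the artinian modules `N` with
  `(0 :_N I)` noetherian form a Serre class; closure under quotients
  (`prop_torsionBySet_of_surjective`) is the essential point. Since `Ext^j(R/I, N)` is built from
  finite powers of `N` by subquotients and extensions, it belongs to that class, and it is killed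
  by `I`.
-/

namespace PairLocalCohomology

/-! ### Melkersson's artinianness criterion -/

section Artinian

variable {R : Type u} [CommRing R]

/-- In a well-founded order, a family indexed by `ℕ × ℕ` and decreasing in both indices becomes
constant in the first index at a stage that does not depend on the second. -/
theorem exists_forall_eq_of_antitone {α : Type*} [PartialOrder α] [WellFoundedLT α]
    (a : ℕ → ℕ → α) (h₁ : ∀ j, Antitone fun i => a i j) (h₂ : ∀ i, Antitone (a i)) :
    ∃ n, ∀ m, n ≤ m → ∀ j, a n j = a m j := by
  obtain ⟨_, ⟨⟨p, q⟩, rfl⟩, hmin⟩ := WellFounded.has_min (wellFounded_lt (α := α))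
    (Set.range fun s : ℕ × ℕ => a s.1 s.2) (Set.range_nonempty _)
  have hpq : ∀ i j, p ≤ i → q ≤ j → a i j = a p q := fun i j hi hj =>
    eq_of_le_of_not_lt ((h₂ i hj).trans (h₁ q hi)) (hmin _ ⟨(i, j), rfl⟩)
  -- Beyond `(p, q)` the family is constant; only the finitely many columns `j < q` remain.
  have hcol : ∀ j, ∃ n, ∀ m, n ≤ m → a n j = a m j := fun j => by
    obtain ⟨_, ⟨n, rfl⟩, hn⟩ := WellFounded.has_min (wellFounded_lt (α := α))
      (Set.range fun i => a i j) (Set.range_nonempty _)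
    exact ⟨n, fun m hm => (eq_of_le_of_not_lt (h₁ j hm) (hn _ ⟨m, rfl⟩)).symm⟩
  choose n hn using hcol
  refine ⟨max p ((Finset.range q).sup n), fun m hm j => ?_⟩
  obtain hj | hj := lt_or_ge j q
  · have hle : n j ≤ max p ((Finset.range q).sup n) :=
      (Finset.le_sup (f := n) (Finset.mem_range.2 hj)).trans (le_max_right _ _)
    rw [← hn j _ hle, ← hn j _ (hle.trans hm)]
  · rw [hpq _ j (le_max_left _ _) hj, hpq _ j ((le_max_left _ _).trans hm) hj]

/-- If every element of `N` is killed by a power of `x` and `(0 :_N x)` is artinian, so is `N`.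
A submodule `K` is measured by the decreasing sequence of submodules `x ^ j K ∩ (0 :_N x)`, and
comparable submodules with the same sequence are equal. -/
theorem isArtinian_of_isArtinian_torsionBy {N : Type*} [AddCommGroup N] [Module R N] (x : R)
    (hx : ∀ y : N, ∃ n : ℕ, x ^ n • y = 0) [IsArtinian R (Submodule.torsionBy R N x)] :
    IsArtinian R N := by
  let L (K : Submodule R N) (j : ℕ) : Submodule R (Submodule.torsionBy R N x) :=
    (K.map (x ^ j • LinearMap.id : N →ₗ[R] N)).comap (Submodule.subtype _)
  -- `L` separates comparable submodules: induct on the power of `x` killing an element of `K'`.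
  have key : ∀ K K' : Submodule R N, K ≤ K' → (∀ j, L K j = L K' j) → K' ≤ K := by
    intro K K' hK hL
    have aux : ∀ n : ℕ, ∀ y ∈ K', x ^ n • y = 0 → y ∈ K := by
      intro n
      induction n with
      | zero => intro y _ hy; simp_all
      | succ n ih =>
        intro y hy h
        have hmem : (⟨x ^ n • y, by
            rw [Submodule.mem_torsionBy_iff, smul_smul, ← pow_succ', h]⟩ :
            Submodule.torsionBy R N x) ∈ L K' n := ⟨y, hy, rfl⟩
        rw [← hL n] at hmem
        obtain ⟨k, hk, hke⟩ := hmem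
        have hke' : x ^ n • k = x ^ n • y := hke
        have := ih (y - k) (K'.sub_mem hy (hK hk)) (by rw [smul_sub, hke', sub_self])
        simpa using K.add_mem this hk
    intro y hy
    obtain ⟨n, hn⟩ := hx y
    exact aux n y hy hn
  rw [← monotone_stabilizes_iff_artinian]
  intro f
  obtain ⟨n, hn⟩ := exists_forall_eq_of_antitone (fun i j => L (f i).ofDual j)
    (fun j i i' hi => Submodule.comap_mono (Submodule.map_mono (f.monotone hi)))
    (fun i => antitone_nat_of_succ_le fun j => Submodule.comap_mono (by
      rintro _ ⟨k, hk, rfl⟩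
      refine ⟨x • k, Submodule.smul_mem _ x hk, ?_⟩
      simp only [LinearMap.smul_apply, LinearMap.id_coe, id_eq, smul_smul, pow_succ]))
  exact ⟨n, fun m hm => le_antisymm (f.monotone hm) (key _ _ (f.monotone hm) fun j => (hn m hm j).symm)⟩

/-- The elements of `(0 :_N I)` killed by `J` are those of `(0 :_N I + J)`. -/
noncomputable def torsionBySetSupEquiv (N : Type*) [AddCommGroup N] [Module R N] (I J : Ideal R) :
    Submodule.torsionBySet R N (I ⊔ J : Ideal R) ≃ₗ[R]
      Submodule.torsionBySet R (Submodule.torsionBySet R N I) J :=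
  LinearEquiv.ofBijective
    (((Submodule.inclusion (Submodule.torsionBySet_le_torsionBySet_of_subset
        (show (I : Set R) ⊆ (I ⊔ J : Ideal R) from SetLike.coe_subset_coe.2 le_sup_left))).codRestrict
      (Submodule.torsionBySet R (Submodule.torsionBySet R N I) J)) fun y => by
        rw [Submodule.mem_torsionBySet_iff]
        intro a
        ext
        exact (Submodule.mem_torsionBySet_iff _ _).1 y.2 ⟨a, Ideal.mem_sup_right a.2⟩)
    ⟨fun a b h => by
      ext
      exact congrArg (fun z => (z.1.1 : N)) h, fun y => ⟨⟨y.1.1, by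
        rw [Submodule.mem_torsionBySet_iff]
        rintro ⟨a, ha⟩
        obtain ⟨b, hb, c, hc, rfl⟩ := Submodule.mem_sup.1 ha
        have h1 := (Submodule.mem_torsionBySet_iff _ _).1 y.1.2 ⟨b, hb⟩
        have h2 := congrArg Subtype.val ((Submodule.mem_torsionBySet_iff _ _).1 y.2 ⟨c, hc⟩)
        change b • y.1.1 = 0 at h1
        change c • y.1.1 = 0 at h2
        change (b + c) • y.1.1 = 0
        rw [add_smul, h1, h2, add_zero]⟩, rfl⟩⟩

/-- Melkersson's criterion: an `I`-torsion module `N` with `(0 :_N I)` artinian is artinian. -/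
theorem isArtinian_of_isArtinian_torsionBySet (I : Ideal R) (hI : I.FG) :
    ∀ (N : Type u) [AddCommGroup N] [Module R N],
      (∀ y : N, ∃ n : ℕ, ∀ a ∈ I, a ^ n • y = 0) → IsArtinian R (Submodule.torsionBySet R N I) →
      IsArtinian R N := by
  induction I, hI using Submodule.fg_induction with
  | singleton x =>
    intro N _ _ h hN
    rw [Submodule.torsionBySet_span_singleton_eq] at hN
    exact isArtinian_of_isArtinian_torsionBy x fun y =>
      (h y).imp fun n hn => hn x (Submodule.mem_span_singleton_self x)
  | sup I J _ _ hI hJ =>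
    intro N _ _ h hN
    refine hI N (fun y => (h y).imp fun n hn a ha => hn a (Ideal.mem_sup_left ha)) ?_
    refine hJ _ (fun y => (h y).imp fun n hn a ha => Subtype.ext (hn a (Ideal.mem_sup_right ha))) ?_
    exact (torsionBySetSupEquiv N I J).isArtinian_iff.1 hN

/-- `(0 :_N m)` is a vector space over `R ⧸ m`, so it is artinian once it is noetherian. -/
theorem isArtinian_torsionBySet_of_isMaximal (m : Ideal R) [m.IsMaximal] (N : Type*)
    [AddCommGroup N] [Module R N] [IsNoetherian R (Submodule.torsionBySet R N m)] :
    IsArtinian R (Submodule.torsionBySet R N m) := by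
  have h := Submodule.torsionBySet_isTorsionBySet (R := R) (M := N) (m : Set R)
  let := h.module
  let := Ideal.Quotient.field m
  have : IsSemisimpleModule R (Submodule.torsionBySet R N m) :=
    h.isSemisimpleModule_iff.1 inferInstance
  have tfae := IsSemisimpleModule.finite_tfae (R := R) (M := Submodule.torsionBySet R N m)
  exact (tfae.out 1 2).1 ‹IsNoetherian R (Submodule.torsionBySet R N m)›

end Artinian

/-! ### Serre classes cut out by `(0 :_N I)` -/

section SerreClass

variable {R : Type u} [CommRing R] (P : ObjectProperty (ModuleCat.{u} R))

theorem prop_of_injective [P.IsClosedUnderSubobjects] {M N : Type u} [AddCommGroup M] [Module R M]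
    [AddCommGroup N] [Module R N] (f : M →ₗ[R] N) (hf : Function.Injective f)
    (hN : P (ModuleCat.of R N)) : P (ModuleCat.of R M) := by
  have : Mono (ModuleCat.ofHom f) := (ModuleCat.mono_iff_injective _).2 hf
  exact P.prop_of_mono (ModuleCat.ofHom f) hN

theorem prop_of_surjective [P.IsClosedUnderQuotients] {M N : Type u} [AddCommGroup M] [Module R M]
    [AddCommGroup N] [Module R N] (f : M →ₗ[R] N) (hf : Function.Surjective f)
    (hM : P (ModuleCat.of R M)) : P (ModuleCat.of R N) := by
  have : Epi (ModuleCat.ofHom f) := (ModuleCat.epi_iff_surjective _).2 hf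
  exact P.prop_of_epi (ModuleCat.ofHom f) hM

variable [P.IsSerreClass]

theorem prop_of_exact {L M N : Type u} [AddCommGroup L] [Module R L] [AddCommGroup M] [Module R M]
    [AddCommGroup N] [Module R N] (f : L →ₗ[R] M) (g : M →ₗ[R] N)
    (hfg : Function.Exact f g) (hL : P (ModuleCat.of R L)) (hN : P (ModuleCat.of R N)) :
    P (ModuleCat.of R M) :=
  P.prop_X₂_of_exact (ModuleCat.shortComplex_exact
    (ModuleCat.shortComplexOfCompEqZero f g hfg.linearMap_comp_eq_zero) hfg) hL hN

theorem prop_torsionBy_pow (N : Type u) [AddCommGroup N] [Module R N] (x : R)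
    (h : P (ModuleCat.of R (Submodule.torsionBy R N x))) (n : ℕ) :
    P (ModuleCat.of R (Submodule.torsionBy R N (x ^ n))) := by
  induction n with
  | zero =>
    refine prop_of_injective P (0 : _ →ₗ[R] Submodule.torsionBy R N x) (fun a b _ => ?_) h
    have := a.2; have := b.2
    ext
    simp_all
  | succ n ih =>
    refine prop_of_exact P
      (Submodule.inclusion (Submodule.torsionBy_le_torsionBy_of_dvd x (x ^ (n + 1)) ⟨x ^ n, pow_succ' x n⟩))
      (((x • LinearMap.id : N →ₗ[R] N).restrict (p := Submodule.torsionBy R N (x ^ (n + 1)))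
        (q := Submodule.torsionBy R N (x ^ n)) fun y hy => by
          rw [Submodule.mem_torsionBy_iff] at hy ⊢
          simpa [smul_smul, ← pow_succ] using hy)) (fun y => ?_) h ih
    constructor
    · intro hy
      exact ⟨⟨y.1, congrArg Subtype.val hy⟩, rfl⟩
    · rintro ⟨z, rfl⟩
      exact Subtype.ext z.2

/-- For `N = M / K` with `M` artinian, `K = x ^ n K + (0 :_K x ^ n)` for large `n`; hence every element
of `(0 :_N x)` lifts to an element of `(0 :_M x ^ (n + 2))`, which is an iterated extension of
submodules of `(0 :_M x)`. -/
theorem prop_torsionBy_of_surjective {M N : Type u} [AddCommGroup M] [Module R M]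
    [AddCommGroup N] [Module R N] [IsArtinian R M] (f : M →ₗ[R] N) (hf : Function.Surjective f)
    (x : R) (h : P (ModuleCat.of R (Submodule.torsionBy R M x))) :
    P (ModuleCat.of R (Submodule.torsionBy R N x)) := by
  obtain ⟨n, hn⟩ := IsArtinian.range_smul_pow_stabilizes (LinearMap.ker f) x
  have key : ∀ y : N, x • y = 0 → ∃ t : M, x ^ (n + 2) • t = 0 ∧ f t = y := by
    intro y hy
    obtain ⟨t, rfl⟩ := hf y
    have hxt : f (x • t) = 0 := by rw [map_smul, hy]
    have : x ^ n • (⟨x • t, hxt⟩ : LinearMap.ker f) ∈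
        LinearMap.range (x ^ n • LinearMap.id : LinearMap.ker f →ₗ[R] LinearMap.ker f) :=
      ⟨_, rfl⟩
    rw [hn (n + 1 + n) (by omega)] at this
    obtain ⟨k, hk⟩ := this
    have hk' : x ^ (n + 1 + n) • k.1 = x ^ n • x • t := congrArg Subtype.val hk
    -- `x ^ (n + 1) • x ^ n • k = x ^ n • (x • t)`, so `t - x ^ n • k` is killed by `x ^ (n + 1)`.
    refine ⟨t - x ^ n • k.1, ?_, ?_⟩
    · have e : x ^ (n + 2) • (t - x ^ n • k.1) =
          x • (x ^ n • x • t - x ^ (n + 1 + n) • k.1) := by module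
      rw [e, hk', sub_self, smul_zero]
    · rw [map_sub, map_smul, LinearMap.mem_ker.1 k.2, smul_zero, sub_zero]
  have h1 : P (ModuleCat.of R ((Submodule.torsionBy R M (x ^ (n + 2))).map f)) :=
    prop_of_surjective P (f.submoduleMap _) (f.submoduleMap_surjective _)
      (prop_torsionBy_pow P M x h (n + 2))
  refine prop_of_injective P (Submodule.inclusion fun y hy => ?_) (Submodule.inclusion_injective _) h1
  obtain ⟨t, ht, rfl⟩ := key y hy
  exact ⟨t, ht, rfl⟩

/-- The artinian modules `N` for which `(0 :_N I)` satisfies `P`. -/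
def artinianTorsionBySet (P : ObjectProperty (ModuleCat.{u} R)) (I : Ideal R) :
    ObjectProperty (ModuleCat.{u} R) :=
  fun N => IsArtinian R N ∧ P (ModuleCat.of R (Submodule.torsionBySet R N I))

/-- The linear map `(0 :_M I) → (0 :_N I)` induced by `f : M → N`. -/
def torsionBySetMap {M N : Type u} [AddCommGroup M] [Module R M]
    [AddCommGroup N] [Module R N] (I : Ideal R) (f : M →ₗ[R] N) :
    Submodule.torsionBySet R M I →ₗ[R] Submodule.torsionBySet R N I :=
  f.restrict fun y hy => by
    rw [Submodule.mem_torsionBySet_iff] at hy ⊢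
    intro a
    rw [← map_smul, hy, map_zero]

/-- `N ↦ (0 :_N I)` is left exact, so only closure under quotients needs an argument. -/
theorem isSerreClass_artinianTorsionBySet (I : Ideal R)
    (hq : ∀ (M N : Type u) [AddCommGroup M] [Module R M] [AddCommGroup N] [Module R N]
      [IsArtinian R M] (f : M →ₗ[R] N), Function.Surjective f →
      P (ModuleCat.of R (Submodule.torsionBySet R M I)) →
      P (ModuleCat.of R (Submodule.torsionBySet R N I))) :
    (artinianTorsionBySet P I).IsSerreClass where
  exists_zero := by
    refine ⟨ModuleCat.of R PUnit, ModuleCat.isZero_of_subsingleton _, ?_, ?_⟩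
    · change IsArtinian R PUnit.{u + 1}
      infer_instance
    · exact P.prop_of_isZero (ModuleCat.isZero_of_subsingleton _)
  prop_of_mono {X Y} f hf h := by
    have hf' := (ModuleCat.mono_iff_injective f).1 hf
    have := h.1
    exact ⟨isArtinian_of_injective f.hom hf', prop_of_injective P (torsionBySetMap I f.hom)
      (fun a b hab => Subtype.ext (hf' (congrArg Subtype.val hab))) h.2⟩
  prop_of_epi {X Y} f hf h := by
    have hf' := (ModuleCat.epi_iff_surjective f).1 hf
    have := h.1
    exact ⟨isArtinian_of_surjective _ f.hom hf', hq X Y f.hom hf' h.2⟩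
  prop_X₂_of_shortExact {S} hS h₁ h₃ := by
    have := h₁.1
    have := h₃.1
    have hinj := hS.moduleCat_injective_f
    refine ⟨isArtinian_of_range_eq_ker S.f.hom S.g.hom hS.exact.moduleCat_range_eq_ker,
      prop_of_exact P (torsionBySetMap I S.f.hom) (torsionBySetMap I S.g.hom)
        (fun y => ⟨fun hy => ?_, ?_⟩) h₁.2 h₃.2⟩
    · obtain ⟨z, hz⟩ := (S.moduleCat_exact_iff.1 hS.exact) y.1 (congrArg Subtype.val hy)
      refine ⟨⟨z, ?_⟩, Subtype.ext hz⟩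
      rw [Submodule.mem_torsionBySet_iff]
      intro a
      apply hinj
      have hy2 := (Submodule.mem_torsionBySet_iff _ _).1 y.2 a
      change S.f.hom _ = S.f.hom _
      rw [map_smul, map_zero]
      change (a : R) • S.f z = 0
      rw [hz, hy2]
    · rintro ⟨z, rfl⟩
      exact Subtype.ext (S.moduleCat_zero_apply z.1)

/-- If `M` is artinian and `(0 :_M I)` lies in a Serre class, so does `(0 :_N I)` for each quotient `N`
of `M`. The induction on generators of `I` needs the statement for all Serre classes at once: for
`I ⊔ J`, the claim for `I` is applied to the Serre class of artinian `N` with `(0 :_N J)` in `P`. -/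
theorem prop_torsionBySet_of_surjective (I : Ideal R) (hI : I.FG) :
    ∀ (P : ObjectProperty (ModuleCat.{u} R)) [P.IsSerreClass]
      (M N : Type u) [AddCommGroup M] [Module R M] [AddCommGroup N] [Module R N]
      [IsArtinian R M] (f : M →ₗ[R] N), Function.Surjective f →
      P (ModuleCat.of R (Submodule.torsionBySet R M I)) →
      P (ModuleCat.of R (Submodule.torsionBySet R N I)) := by
  induction I, hI using Submodule.fg_induction with
  | singleton x =>
    intro P _ M N _ _ _ _ _ f hf h
    rw [Submodule.torsionBySet_span_singleton_eq] at h ⊢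
    exact prop_torsionBy_of_surjective P f hf x h
  | sup I J _ _ hI hJ =>
    intro P _ M N _ _ _ _ _ f hf h
    have := isSerreClass_artinianTorsionBySet P J (hJ P)
    have h1 : artinianTorsionBySet P J (ModuleCat.of R (Submodule.torsionBySet R M I)) :=
      ⟨inferInstanceAs (IsArtinian R (Submodule.torsionBySet R M I)),
        P.prop_of_iso (torsionBySetSupEquiv M I J).toModuleIso h⟩
    have h2 := hI (artinianTorsionBySet P J) M N f hf h1
    exact P.prop_of_iso (torsionBySetSupEquiv N I J).symm.toModuleIso h2.2

/-- The property of being a noetherian module. -/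
def noetherianModule (R : Type u) [CommRing R] : ObjectProperty (ModuleCat.{u} R) :=
  fun N => IsNoetherian R N

instance : (noetherianModule R).IsSerreClass where
  exists_zero := by
    refine ⟨ModuleCat.of R PUnit, ModuleCat.isZero_of_subsingleton _, ?_⟩
    change IsNoetherian R PUnit.{u + 1}
    infer_instance
  prop_of_mono {X Y} f hf h := by
    have : IsNoetherian R Y := h
    exact isNoetherian_of_injective f.hom ((ModuleCat.mono_iff_injective f).1 hf)
  prop_of_epi {X Y} f hf h := by
    have : IsNoetherian R X := h
    exact isNoetherian_of_surjective f.hom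
      (LinearMap.range_eq_top.2 ((ModuleCat.epi_iff_surjective f).1 hf))
  prop_X₂_of_shortExact {S} hS h₁ h₃ := by
    have : IsNoetherian R S.X₁ := h₁
    have : IsNoetherian R S.X₃ := h₃
    exact isNoetherian_of_range_eq_ker S.f.hom S.g.hom hS.exact.moduleCat_range_eq_ker

instance [IsNoetherianRing R] (I : Ideal R) :
    (artinianTorsionBySet (noetherianModule R) I).IsSerreClass :=
  isSerreClass_artinianTorsionBySet _ I
    (prop_torsionBySet_of_surjective I (IsNoetherian.noetherian I) (noetherianModule R))

end SerreClass

/-! ### Finiteness of `Ext` modules -/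

section ExtSerre

open Abelian

variable {R : Type u} [CommRing R]

theorem prop_pi (P : ObjectProperty (ModuleCat.{u} R)) [P.IsSerreClass] (N : Type u)
    [AddCommGroup N] [Module R N] (hN : P (ModuleCat.of R N)) (n : ℕ) :
    P (ModuleCat.of R (Fin n → N)) := by
  induction n with
  | zero => exact P.prop_of_isZero (ModuleCat.isZero_of_subsingleton _)
  | succ n ih =>
    refine prop_of_exact P (LinearMap.single R (fun _ : Fin (n + 1) => N) 0)
      (LinearMap.pi fun i : Fin n => LinearMap.proj i.succ) (fun y => ⟨fun hy => ?_, ?_⟩) hN ih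
    · refine ⟨y 0, funext fun i => ?_⟩
      refine Fin.cases (by simp) (fun i => ?_) i
      simpa using (congrFun hy i).symm
    · rintro ⟨z, rfl⟩
      ext i
      simp

theorem prop_linearMap (P : ObjectProperty (ModuleCat.{u} R)) [P.IsSerreClass] (L N : Type u)
    [AddCommGroup L] [Module R L] [AddCommGroup N] [Module R N] [Module.Finite R L]
    (hN : P (ModuleCat.of R N)) : P (ModuleCat.of R (L →ₗ[R] N)) := by
  obtain ⟨n, f, hf⟩ := Module.Finite.exists_fin' R L
  refine prop_of_injective P (LinearMap.pi fun i => LinearMap.applyₗ (f (Pi.single i 1)))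
    (fun φ ψ h => ?_) (prop_pi P N hN n)
  rw [← LinearMap.cancel_right hf]
  refine LinearMap.pi_ext' fun i => LinearMap.ext_ring ?_
  exact congrFun h i

/-- If `N` lies in a Serre class and `L` is finitely generated over a noetherian ring, then all
`Ext^j(L, N)` lie in the class: shift dimension along a finite free presentation of `L`. -/
theorem prop_ext [IsNoetherianRing R] (P : ObjectProperty (ModuleCat.{u} R)) [P.IsSerreClass]
    (N : ModuleCat.{u} R) (hN : P N) (L : ModuleCat.{u} R) [Module.Finite R L] (j : ℕ) :
    P (ModuleCat.of R (Ext L N j)) := by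
  induction j generalizing L with
  | zero =>
    exact P.prop_of_iso (Ext.linearEquiv₀.trans ModuleCat.homLinearEquiv).symm.toModuleIso
      (prop_linearMap P L N hN)
  | succ n ih =>
    obtain ⟨F, _, _, _, _, f, surjf⟩ := Module.exists_finite_presentation R L
    let exac := LinearMap.shortExact_shortComplexKer surjf
    exact prop_of_surjective P (exac.extClass.precompOfLinear R N (add_comm 1 n))
      (precomp_extClass_surjective_of_projective_X₂ N exac n) (ih _)

theorem smul_ext_quotient_eq_zero (I : Ideal R) (N : ModuleCat.{u} R) (j : ℕ) (a : R) (ha : a ∈ I)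
    (y : Ext (ModuleCat.of R (R ⧸ I)) N j) : a • y = 0 := by
  have h : a • 𝟙 (ModuleCat.of R (R ⧸ I)) = 0 := by
    refine ModuleCat.hom_ext (LinearMap.ext fun x => ?_)
    obtain ⟨r, rfl⟩ := Ideal.Quotient.mk_surjective x
    change a • (Ideal.Quotient.mk I r) = 0
    rw [← Ideal.Quotient.mk_eq_mk, ← Submodule.Quotient.mk_smul, Submodule.Quotient.mk_eq_zero]
    exact I.mul_mem_right r ha
  rw [← Ext.mk₀_id_comp y, ← Ext.smul_comp, ← Ext.mk₀_smul, h, Ext.mk₀_zero, Ext.zero_comp]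

/-- An artinian module `N` with `(0 :_N I)` finitely generated has finitely generated
`Ext^j(R/I, N)`: modules of this kind form a Serre class, which then contains `Ext^j(R/I, N)`, and
`Ext^j(R/I, N)` is killed by `I`. -/
theorem finite_ext_of_isArtinian [IsNoetherianRing R] (I : Ideal R) (N : ModuleCat.{u} R)
    [IsArtinian R N] [IsNoetherian R (Submodule.torsionBySet R N I)] (j : ℕ) :
    Module.Finite R (Ext (ModuleCat.of R (R ⧸ I)) N j) := by
  have h := (prop_ext (artinianTorsionBySet (noetherianModule R) I) N ⟨‹_›, ‹_›⟩
    (ModuleCat.of R (R ⧸ I)) j).2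
  have htop : Submodule.torsionBySet R (Ext (ModuleCat.of R (R ⧸ I)) N j) I = ⊤ :=
    eq_top_iff.2 fun y _ => (Submodule.mem_torsionBySet_iff _ _).2 fun a =>
      smul_ext_quotient_eq_zero I N j a a.2 y
  have h' : IsNoetherian R (Submodule.torsionBySet R (Ext (ModuleCat.of R (R ⧸ I)) N j) I) := h
  rw [htop, isNoetherian_top_iff] at h'
  infer_instance

theorem finite_ext_of_linearEquiv (X : ModuleCat.{u} R) {M N : Type u} [AddCommGroup M]
    [Module R M] [AddCommGroup N] [Module R N] (e : M ≃ₗ[R] N) (k : ℕ)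
    (h : Module.Finite R (Ext X (ModuleCat.of R M) k)) :
    Module.Finite R (Ext X (ModuleCat.of R N) k) := by
  refine Module.Finite.of_surjective
    ((Ext.mk₀ e.toModuleIso.hom).postcompOfLinear R X (add_zero k)) fun x =>
      ⟨x.comp (Ext.mk₀ e.toModuleIso.inv) (add_zero k), ?_⟩
  change (x.comp (Ext.mk₀ e.toModuleIso.inv) (add_zero k)).comp
    (Ext.mk₀ e.toModuleIso.hom) (add_zero k) = x
  rw [Ext.comp_assoc_of_second_deg_zero, Ext.mk₀_comp_mk₀, Iso.inv_hom_id, Ext.comp_mk₀_id]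

variable (X : ModuleCat.{u} R) {S : ShortComplex (ModuleCat.{u} R)} (hS : S.ShortExact)
include hS

theorem finite_ext_X₂ [IsNoetherianRing R] (k : ℕ) (h₁ : Module.Finite R (Ext X S.X₁ k))
    (h₃ : Module.Finite R (Ext X S.X₃ k)) : Module.Finite R (Ext X S.X₂ k) := by
  have := isNoetherian_of_range_eq_ker ((Ext.mk₀ S.f).postcompOfLinear R X (add_zero k))
    ((Ext.mk₀ S.g).postcompOfLinear R X (add_zero k)) (le_antisymm ?_ fun x hx =>
      Ext.covariant_sequence_exact₂ X hS x hx)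
  · infer_instance
  · rintro _ ⟨x, rfl⟩
    simp

theorem finite_ext_X₃_of_injective [IsNoetherianRing R] [Injective S.X₂] (k : ℕ)
    (h₁ : Module.Finite R (Ext X S.X₁ (k + 2))) :
    Module.Finite R (Ext X S.X₃ (k + 1)) := by
  refine Module.Finite.of_injective (hS.extClass.postcompOfLinear R X rfl) ?_
  rw [← LinearMap.ker_eq_bot, eq_bot_iff]
  intro x hx
  obtain ⟨y, rfl⟩ := Ext.covariant_sequence_exact₃ X hS x rfl hx
  rw [Ext.eq_zero_of_injective y]
  simp

/-- `Hom(X, X₃)` is an extension of a submodule of `Ext^1(X, X₁)` by the image of `Hom(X, X₂)`. -/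
theorem isNoetherian_ext_zero_X₃ (h₁ : IsNoetherian R (Ext X S.X₁ 1))
    (h : IsNoetherian R (LinearMap.range ((Ext.mk₀ S.g).postcompOfLinear R X (add_zero 0)))) :
    IsNoetherian R (Ext X S.X₃ 0) := by
  refine isNoetherian_of_range_eq_ker (LinearMap.range
    ((Ext.mk₀ S.g).postcompOfLinear R X (add_zero 0))).subtype
    (hS.extClass.postcompOfLinear R X (zero_add 1)) ?_
  rw [Submodule.range_subtype]
  refine le_antisymm ?_ fun x hx => Ext.covariant_sequence_exact₃ X hS x (zero_add 1) hx
  rintro _ ⟨x, rfl⟩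
  simp [Ext.comp_assoc_of_second_deg_zero]

end ExtSerre

/-! ### The `(I, J)`-torsion submodule -/

section Torsion

variable {R : Type u} [CommRing R] (I J : Ideal R)

theorem mem_torsion_iff {M : Type u} [AddCommGroup M] [Module R M] (y : M) :
    y ∈ torsion I J M ↔
      PrimeSpectrum.zeroLocus ((Submodule.span R {y}).annihilator : Set R) ⊆ W I J := by
  change Module.support R (Submodule.span R {y}) ⊆ W I J ↔ _
  rw [Module.support_eq_zeroLocus]

theorem zeroLocus_subset_W : PrimeSpectrum.zeroLocus (I : Set R) ⊆ W I J :=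
  fun p hp => ⟨1, le_rfl, by
    rw [pow_one]
    exact (show I ≤ p.asIdeal from hp).trans le_sup_left⟩

theorem torsionBySet_le_torsion (M : Type u) [AddCommGroup M] [Module R M] :
    Submodule.torsionBySet R M I ≤ torsion I J M := by
  intro y hy
  rw [mem_torsion_iff]
  refine (PrimeSpectrum.zeroLocus_anti_mono fun a ha => ?_).trans (zeroLocus_subset_W I J)
  exact (Submodule.mem_annihilator_span_singleton _ _).2
    ((Submodule.mem_torsionBySet_iff _ _).1 hy ⟨a, ha⟩)

/-- Over a local ring `p + J` is a proper ideal, so `W(R, J)` is empty. -/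
theorem torsion_top_left (hJ : J ≠ ⊤) [IsLocalRing R] (M : Type u) [AddCommGroup M] [Module R M] :
    torsion ⊤ J M = ⊥ := by
  have hW : W ⊤ J = (∅ : Set (PrimeSpectrum R)) := by
    refine Set.eq_empty_of_forall_notMem fun p hp => ?_
    obtain ⟨n, -, hn⟩ := hp
    rw [Ideal.top_pow, top_le_iff] at hn
    exact (IsLocalRing.maximalIdeal.isMaximal R).ne_top (top_le_iff.1 (hn ▸ sup_le
      (IsLocalRing.le_maximalIdeal p.2.ne_top) (IsLocalRing.le_maximalIdeal hJ)))
  refine eq_bot_iff.2 fun y hy => ?_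
  have h : Module.support R (Submodule.span R {y}) ⊆ W ⊤ J := hy
  rw [hW, Set.subset_empty_iff, Module.support_eq_empty_iff] at h
  exact congrArg Subtype.val
    (Subsingleton.elim (⟨y, Submodule.mem_span_singleton_self y⟩ : Submodule.span R {y}) 0)

/-- `Γ_{I,J}` preserves injective modules. For `g : a → Γ_{I,J}(E)` let `b` be the annihilator of the
image of `g`. By Artin–Rees `a ∩ b ^ (k + 1) ⊆ b a ⊆ ker g` for some `k`, so `g` factors through the
image of `a` in `R / b ^ (k + 1)` and extends to `R / b ^ (k + 1) → E`; the values of this extension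
are killed by `b ^ (k + 1)`, and `V(b) ⊆ W(I, J)`. -/
theorem injective_torsion [IsNoetherianRing R] (E : Type u) [AddCommGroup E] [Module R E]
    [Module.Injective R E] : Module.Injective R (torsion I J E) := by
  refine Module.Baer.injective fun a g => ?_
  set b := (LinearMap.range g).annihilator with hb
  have hbW : PrimeSpectrum.zeroLocus (b : Set R) ⊆ W I J := by
    rw [hb, Submodule.annihilator, ← Module.support_eq_zeroLocus]
    intro p hp
    obtain ⟨⟨y, hy⟩, hp⟩ := Module.mem_support_iff_exists_annihilator.1 hp
    refine (mem_torsion_iff I J y.1).1 y.2 ?_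
    refine le_trans (fun r hr => ?_) hp
    rw [Submodule.mem_annihilator_span_singleton] at hr ⊢
    exact Subtype.ext (Subtype.ext hr)
  obtain ⟨k, hk⟩ := b.exists_pow_inf_eq_pow_smul (M := R) a
  have hker : ∀ r (hr : r ∈ a), r ∈ b ^ (k + 1) → g ⟨r, hr⟩ = 0 := by
    intro r hr hrb
    have hmem : r ∈ b ^ (k + 1) • (⊤ : Ideal R) ⊓ a := ⟨by simpa using hrb, hr⟩
    rw [hk (k + 1) (Nat.le_succ k), Nat.add_sub_cancel_left, pow_one] at hmem
    have hle : b • (b ^ k • (⊤ : Ideal R) ⊓ a) ≤ (LinearMap.ker g).map a.subtype := by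
      rw [Submodule.smul_le]
      rintro s hs t ⟨-, ht⟩
      refine ⟨s • ⟨t, ht⟩, ?_, rfl⟩
      rw [SetLike.mem_coe, LinearMap.mem_ker, map_smul]
      exact Submodule.mem_annihilator.1 hs _ ⟨_, rfl⟩
    obtain ⟨z, hz, rfl⟩ := hle hmem
    exact hz
  let f : a →ₗ[R] R ⧸ b ^ (k + 1) := (b ^ (k + 1)).mkQ ∘ₗ a.subtype
  have hf : LinearMap.ker f ≤ LinearMap.ker g := fun z hz =>
    hker z.1 z.2 ((Submodule.Quotient.mk_eq_zero _).1 hz)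
  obtain ⟨h, hh⟩ := Module.Injective.out ((LinearMap.ker f).liftQ f le_rfl)
    (LinearMap.ker_eq_bot.1 (Submodule.ker_liftQ_eq_bot' _ f rfl))
    ((torsion I J E).subtype ∘ₗ (LinearMap.ker f).liftQ g hf)
  have hmem : ∀ r, h ((b ^ (k + 1)).mkQ r) ∈ torsion I J E := by
    intro r
    rw [mem_torsion_iff]
    refine (PrimeSpectrum.zeroLocus_anti_mono (s := ((b ^ (k + 1) : Ideal R) : Set R))
      fun s hs => ?_).trans ((PrimeSpectrum.zeroLocus_pow b (Nat.succ_ne_zero k)).trans_subset hbW)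
    rw [SetLike.mem_coe, Submodule.mem_annihilator_span_singleton, ← map_smul, ← map_smul]
    have : (b ^ (k + 1)).mkQ (s • r) = 0 :=
      (Submodule.Quotient.mk_eq_zero _).2 (Ideal.mul_mem_right r _ hs)
    rw [this, map_zero]
  exact ⟨(h ∘ₗ (b ^ (k + 1)).mkQ).codRestrict _ hmem, fun r hr =>
    Subtype.ext (hh ((LinearMap.ker f).mkQ ⟨r, hr⟩))⟩

theorem exists_pow_smul_eq_zero_of_support_subset [IsNoetherianRing R] {M : Type u}
    [AddCommGroup M] [Module R M]
    (h : Module.support R M ⊆ PrimeSpectrum.zeroLocus (I : Set R)) (y : M) :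
    ∃ n : ℕ, I ^ n ≤ (Submodule.span R {y}).annihilator := by
  refine Ideal.exists_pow_le_of_le_radical_of_fg ?_ (IsNoetherian.noetherian I)
  rw [← PrimeSpectrum.zeroLocus_subset_zeroLocus_iff]
  have := (Module.support_subset_of_injective (Submodule.span R {y}).subtype
    Subtype.val_injective).trans h
  rwa [Module.support_eq_zeroLocus] at this

/-- Over a noetherian local ring with maximal ideal `m`, a module `M` supported at `m` with
`(0 :_M I)` noetherian for some proper ideal `I` is artinian, because `(0 :_M m) ⊆ (0 :_M I)`. -/
theorem isArtinian_of_isNoetherian_torsionBySet [IsNoetherianRing R] [IsLocalRing R]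
    (hI : I ≠ ⊤) (M : Type u) [AddCommGroup M] [Module R M]
    (h : Module.support R M ⊆ {IsLocalRing.closedPoint R})
    [IsNoetherian R (Submodule.torsionBySet R M I)] : IsArtinian R M := by
  have hle : Submodule.torsionBySet R M (IsLocalRing.maximalIdeal R) ≤
      Submodule.torsionBySet R M I :=
    Submodule.torsionBySet_le_torsionBySet_of_subset (IsLocalRing.le_maximalIdeal hI)
  have := isNoetherian_of_le hle
  refine isArtinian_of_isArtinian_torsionBySet (IsLocalRing.maximalIdeal R)
    (IsNoetherian.noetherian _) M (fun y => ?_)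
    (isArtinian_torsionBySet_of_isMaximal (IsLocalRing.maximalIdeal R) M)
  have h' : Module.support R M ⊆
      PrimeSpectrum.zeroLocus (IsLocalRing.maximalIdeal R : Set R) := by
    intro p hp
    rw [h hp]
    exact Set.Subset.rfl
  obtain ⟨n, hn⟩ := exists_pow_smul_eq_zero_of_support_subset _ h' y
  exact ⟨n, fun a ha => (Submodule.mem_annihilator_span_singleton _ _).1
    (hn (Ideal.pow_mem_pow ha n))⟩

end Torsion

/-! ### Cochain complexes of injective modules -/

section Complex

open Abelian

theorem isNoetherian_range_of_ker_le_ker {R A B C : Type*} [Ring R] [AddCommGroup A] [Module R A]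
    [AddCommGroup B] [Module R B] [AddCommGroup C] [Module R C] (f : A →ₗ[R] B) (g : A →ₗ[R] C)
    [IsNoetherian R C] (h : LinearMap.ker g ≤ LinearMap.ker f) :
    IsNoetherian R (LinearMap.range f) := by
  have := isNoetherian_of_linearEquiv g.quotKerEquivRange.symm
  rw [← Submodule.range_liftQ _ f h]
  infer_instance

variable {R : Type u} [CommRing R] {A : ℕ → Type u} [∀ n, AddCommGroup (A n)]
  [∀ n, Module R (A n)]

/-- The coboundaries of a complex `A 0 → A 1 → ⋯`, as submodules of the `A n`; they vanish in
degree `0`. -/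
def boundaries (d : ∀ n, A n →ₗ[R] A (n + 1)) : ∀ n, Submodule R (A n)
  | 0 => ⊥
  | n + 1 => LinearMap.range (d n)

/-- The cohomology of a complex `A 0 → A 1 → ⋯`: the quotient of `ker (d n)` by its submodule
`boundaries d n`. -/
abbrev cohomology (d : ∀ n, A n →ₗ[R] A (n + 1)) (n : ℕ) : Type u :=
  LinearMap.ker (d n) ⧸ (boundaries d n).submoduleOf (LinearMap.ker (d n))

theorem boundaries_le_ker (d : ∀ n, A n →ₗ[R] A (n + 1))
    (hd : ∀ n, d (n + 1) ∘ₗ d n = 0) : ∀ n, boundaries d n ≤ LinearMap.ker (d n)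
  | 0 => bot_le
  | n + 1 => LinearMap.range_le_ker_iff.2 (hd n)

/-- The sequence `0 → B^n → Z^n → H^n → 0` of coboundaries, cocycles and cohomology. -/
abbrev boundariesCycles (d : ∀ n, A n →ₗ[R] A (n + 1)) (hd : ∀ n, d (n + 1) ∘ₗ d n = 0) (n : ℕ) :
    ShortComplex (ModuleCat.{u} R) :=
  ModuleCat.shortComplexOfCompEqZero (Submodule.inclusion (boundaries_le_ker d hd n))
    ((boundaries d n).submoduleOf (LinearMap.ker (d n))).mkQ
    (LinearMap.ext fun y => (Submodule.Quotient.mk_eq_zero _).2 y.2)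

theorem boundariesCycles_shortExact (d : ∀ n, A n →ₗ[R] A (n + 1))
    (hd : ∀ n, d (n + 1) ∘ₗ d n = 0) (n : ℕ) : (boundariesCycles d hd n).ShortExact :=
  ModuleCat.shortComplex_shortExact _
    (fun y => ⟨fun hy => ⟨⟨y.1, (Submodule.Quotient.mk_eq_zero
        ((boundaries d n).submoduleOf (LinearMap.ker (d n)))).1 hy⟩, rfl⟩, by
      rintro ⟨z, rfl⟩
      exact (Submodule.Quotient.mk_eq_zero _).2 z.2⟩)
    (Submodule.inclusion_injective (boundaries_le_ker d hd n)) (Submodule.mkQ_surjective _)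

/-- The sequence `0 → Z^n → A^n → B^(n+1) → 0` induced by the differential. -/
abbrev cyclesBoundaries (d : ∀ n, A n →ₗ[R] A (n + 1)) (n : ℕ) :
    ShortComplex (ModuleCat.{u} R) :=
  ModuleCat.shortComplexOfCompEqZero (N := A n) (L := boundaries d (n + 1))
    (LinearMap.ker (d n)).subtype (d n).rangeRestrict
    (LinearMap.ext fun y => Subtype.ext y.2)

theorem cyclesBoundaries_shortExact (d : ∀ n, A n →ₗ[R] A (n + 1)) (n : ℕ) :
    (cyclesBoundaries d n).ShortExact :=
  ModuleCat.shortComplex_shortExact _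
    (fun y => ⟨fun hy => ⟨⟨y, congrArg Subtype.val hy⟩, rfl⟩, by
      rintro ⟨z, rfl⟩
      exact Subtype.ext z.2⟩)
    Subtype.val_injective (d n).surjective_rangeRestrict

variable [IsNoetherianRing R]

/-- For a complex of injective modules with all `Ext^k(X, H^j)` finitely generated for `j < i`, the
modules `Ext^k(X, B^i)` are finitely generated for `k ≥ 1`. -/
theorem finite_ext_boundaries (X : ModuleCat.{u} R) (d : ∀ n, A n →ₗ[R] A (n + 1))
    (hd : ∀ n, d (n + 1) ∘ₗ d n = 0) [∀ n, Module.Injective R (A n)] (i : ℕ)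
    (h : ∀ j < i, ∀ k, Module.Finite R (Ext X (ModuleCat.of R (cohomology d j)) k)) (k : ℕ) :
    Module.Finite R (Ext X (ModuleCat.of R (boundaries d i)) (k + 1)) := by
  induction i generalizing k with
  | zero =>
    have : Module.Finite R (boundaries d 0) :=
      inferInstanceAs (Module.Finite R (⊥ : Submodule R (A 0)))
    have hinj : Injective (ModuleCat.of R (boundaries d 0)) :=
      Limits.IsZero.injective (@ModuleCat.isZero_of_subsingleton R _ _
        (inferInstanceAs (Subsingleton (⊥ : Submodule R (A 0)))))
    have := Ext.subsingleton_of_injective X (ModuleCat.of R (boundaries d 0)) k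
    infer_instance
  | succ i ih =>
    have : Injective (cyclesBoundaries d i).X₂ :=
      Module.injective_object_of_injective_module R (A i)
    exact finite_ext_X₃_of_injective X (cyclesBoundaries_shortExact d i) k
      (finite_ext_X₂ X (boundariesCycles_shortExact d hd i) (k + 2)
        (ih (fun j hj => h j (hj.trans (Nat.lt_succ_self i))) (k + 1)) (h i (Nat.lt_succ_self i) _))

omit [IsNoetherianRing R] in
theorem isNoetherian_torsionBySet_of_ext (I : Ideal R) (N : Type u) [AddCommGroup N] [Module R N]
    (h : IsNoetherian R (Ext (ModuleCat.of R (R ⧸ I)) (ModuleCat.of R N) 0)) :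
    IsNoetherian R (Submodule.torsionBySet R N I) := by
  have := isNoetherian_of_linearEquiv (Ext.linearEquiv₀ (R := R)
    (X := ModuleCat.of R (R ⧸ I)) (Y := ModuleCat.of R N) |>.trans ModuleCat.homLinearEquiv)
  let ev : ((R ⧸ I) →ₗ[R] N) →ₗ[R] N := LinearMap.applyₗ (Ideal.Quotient.mk I 1)
  refine isNoetherian_of_le (t := LinearMap.range ev) fun y hy => ?_
  refine ⟨Submodule.liftQ I (LinearMap.toSpanSingleton R N y) fun a ha => ?_, ?_⟩
  · exact (Submodule.mem_torsionBySet_iff _ _).1 hy ⟨a, ha⟩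
  · exact one_smul R y

/-- Let `A` be an injective resolution of a noetherian module and `G ⊆ A` a subcomplex of injective
modules containing all elements killed by `I`. If `Ext^k(R/I, H^j(G))` is finitely generated for all
`j < i` and all `k`, then so is `(0 : I)` in `H^i(G)`. -/
theorem isNoetherian_torsionBySet_cohomology (I : Ideal R) (d : ∀ n, A n →ₗ[R] A (n + 1))
    (hd : ∀ n, d (n + 1) ∘ₗ d n = 0) (hexact : ∀ n, LinearMap.ker (d (n + 1)) ≤ LinearMap.range (d n))
    [∀ n, Module.Injective R (A n)] [IsNoetherian R (LinearMap.ker (d 0))]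
    (G : ∀ n, Submodule R (A n)) [∀ n, Module.Injective R (G n)]
    (hG : ∀ n, ∀ y ∈ G n, d n y ∈ G (n + 1))
    (htors : ∀ n, Submodule.torsionBySet R (A n) I ≤ G n) (i : ℕ)
    (h : ∀ j < i, ∀ k, Module.Finite R (Ext (ModuleCat.of R (R ⧸ I))
      (ModuleCat.of R (cohomology (fun n => (d n).restrict (hG n)) j)) k)) :
    IsNoetherian R
      (Submodule.torsionBySet R (cohomology (fun n => (d n).restrict (hG n)) i) I) := by
  set dG : ∀ n, G n →ₗ[R] G (n + 1) := fun n => (d n).restrict (hG n) with hdG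
  have hdG' : ∀ n, dG (n + 1) ∘ₗ dG n = 0 := fun n => LinearMap.ext fun y =>
    Subtype.ext (LinearMap.congr_fun (hd n) y.1)
  cases i with
  | zero =>
    have : IsNoetherian R (LinearMap.ker (dG 0)) :=
      isNoetherian_of_injective ((G 0).subtype.restrict (p := LinearMap.ker (dG 0))
        (q := LinearMap.ker (d 0)) fun y hy => congrArg Subtype.val hy)
        fun a b hab => Subtype.ext (Subtype.ext (congrArg (fun z => z.1) hab))
    infer_instance
  | succ n =>
    refine isNoetherian_torsionBySet_of_ext I _ ?_
    -- The cohomology of `A` is finitely generated in degree `0` and zero elsewhere.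
    have hfin : ∀ j k, Module.Finite R (Ext (ModuleCat.of R (R ⧸ I))
        (ModuleCat.of R (cohomology d j)) k) := by
      intro j k
      have : Module.Finite R (cohomology d j) := by
        cases j with
        | zero => infer_instance
        | succ j =>
          have : Subsingleton (cohomology d (j + 1)) :=
            Submodule.Quotient.subsingleton_iff.2
              (eq_top_iff.2 fun y _ => hexact j y.2)
          infer_instance
      infer_instance
    have hZ : Module.Finite R (Ext (ModuleCat.of R (R ⧸ I))
        (ModuleCat.of R (LinearMap.ker (d n))) 1) :=
      finite_ext_X₂ _ (boundariesCycles_shortExact d hd n) 1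
        (finite_ext_boundaries _ d hd n (fun j _ => hfin j) 0) (hfin n 1)
    refine isNoetherian_ext_zero_X₃ _ (boundariesCycles_shortExact dG hdG' (n + 1)) ?_ ?_
    · have := finite_ext_boundaries (ModuleCat.of R (R ⧸ I)) dG hdG' (n + 1) h 0
      exact isNoetherian_of_isNoetherianRing_of_finite R _
    -- Maps `R/I → A^n` land in `G^n`. So if `R/I → Z^(n+1)(G)` lifts along `A^n → B^(n+1)(A)`, it
    -- lifts along `G^n → Z^(n+1)(G)` and dies in `H^(n+1)(G)`: the kernel of
    -- `Hom(R/I, Z^(n+1)(G)) → Ext^1(R/I, Z^n(A))` is contained in the kernel of the map to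
    -- `Hom(R/I, H^(n+1)(G))`.
    let ι : LinearMap.ker (dG (n + 1)) →ₗ[R] boundaries d (n + 1) :=
      (G (n + 1)).subtype.restrict fun y hy => hexact n (congrArg Subtype.val hy)
    have : IsNoetherian R (Ext (ModuleCat.of R (R ⧸ I)) (cyclesBoundaries d n).X₁ (0 + 1)) :=
      isNoetherian_of_isNoetherianRing_of_finite R (Ext (ModuleCat.of R (R ⧸ I))
        (ModuleCat.of R (LinearMap.ker (d n))) 1)
    refine isNoetherian_range_of_ker_le_ker _
      (((cyclesBoundaries_shortExact d n).extClass.postcompOfLinear R _ rfl) ∘ₗ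
        ((Ext.mk₀ (ModuleCat.ofHom ι)).postcompOfLinear R _ (add_zero 0))) fun x hx => ?_
    obtain ⟨y, hy⟩ := Ext.covariant_sequence_exact₃ _ (cyclesBoundaries_shortExact d n) _ rfl hx
    obtain ⟨φ, rfl⟩ := Ext.mk₀_bijective _ _ |>.2 x
    obtain ⟨ψ, rfl⟩ := Ext.mk₀_bijective _ _ |>.2 y
    replace hy : ψ ≫ (cyclesBoundaries d n).g = φ ≫ ModuleCat.ofHom ι := by
      apply (Ext.mk₀_bijective _ _).1
      exact (Ext.mk₀_comp_mk₀ _ _).symm.trans (hy.trans (Ext.mk₀_comp_mk₀ _ _))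
    have hmem : ∀ z, ψ z ∈ G n := fun z => htors n ((Submodule.mem_torsionBySet_iff _ _).2 fun a => by
      have hz : (a : R) • z = 0 := by
        obtain ⟨r, rfl⟩ := Ideal.Quotient.mk_surjective z
        exact Ideal.Quotient.eq_zero_iff_mem.2 (I.mul_mem_right r a.2)
      rw [← map_zero ψ.hom, ← hz, map_smul])
    have hφ : φ ≫ (boundariesCycles dG hdG' (n + 1)).g = 0 := by
      refine ModuleCat.hom_ext (LinearMap.ext fun z => ?_)
      refine (Submodule.Quotient.mk_eq_zero _).2 ⟨⟨ψ z, hmem z⟩, Subtype.ext ?_⟩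
      have h2 : d n (ψ.hom z) = (φ.hom z).1.1 :=
        congrArg (fun f => ((f.hom z : boundaries d (n + 1)) : A (n + 1))) hy
      exact h2
    rw [LinearMap.mem_ker]
    change (Ext.mk₀ φ).comp (Ext.mk₀ (boundariesCycles dG hdG' (n + 1)).g) (zero_add 0) = 0
    rw [Ext.mk₀_comp_mk₀, hφ, Ext.mk₀_zero]

end Complex

/-! ### Local cohomology -/

section Main

variable {R : Type u} [CommRing R]

/-- The homology of a cochain complex of modules is the cohomology of the underlying linear maps. -/
theorem nonempty_homology_linearEquiv (K : CochainComplex (ModuleCat.{u} R) ℕ) (n : ℕ) :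
    Nonempty (K.homology n ≃ₗ[R] cohomology (fun n => (K.d n (n + 1)).hom) n) := by
  let d : ∀ n, K.X n →ₗ[R] K.X (n + 1) := fun n => (K.d n (n + 1)).hom
  have key (i : ℕ) (hi : (ComplexShape.up ℕ).prev n = i)
      (h : LinearMap.range (K.sc' i n (n + 1)).moduleCatToCycles =
        (boundaries d n).submoduleOf (LinearMap.ker (d n))) :
      Nonempty (K.homology n ≃ₗ[R] cohomology d n) :=
    ⟨(K.homologyIsoSc' i n (n + 1) hi (by simp) ≪≫
      (K.sc' i n (n + 1)).moduleCatHomologyIso).toLinearEquiv.trans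
        (Submodule.quotEquivOfEq _ _ h)⟩
  cases n with
  | zero =>
    refine key 0 (by simp) ?_
    rw [LinearMap.range_eq_bot.2]
    · exact (Submodule.ker_subtype _).symm
    · refine LinearMap.ext fun y => Subtype.ext ?_
      change (K.d 0 0).hom y = 0
      rw [K.shape 0 0 (by simp)]
      rfl
  | succ n =>
    refine key n (by simp) (le_antisymm ?_ ?_)
    · rintro _ ⟨y, rfl⟩
      exact ⟨y, rfl⟩
    · rintro ⟨y, hy⟩ ⟨z, hz⟩
      exact ⟨z, Subtype.ext hz⟩

/-- The inductive step: cofiniteness of `H^j_{I,J}(M)` for all `j < i` forces `(0 : I)` in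
`H^i_{I,J}(M)` to be finitely generated. -/
theorem isNoetherian_torsionBySet_localCohomology [IsNoetherianRing R] (I J : Ideal R)
    (M : Type u) [AddCommGroup M] [Module R M] [Module.Finite R M] (i : ℕ)
    (h : ∀ j < i, IsCofinite I (localCohomology I J j M)) :
    IsNoetherian R (Submodule.torsionBySet R (localCohomology I J i M) I) := by
  let E := InjectiveResolution.of (ModuleCat.of R M)
  let K := ((torsionFunctor I J).mapHomologicalComplex (ComplexShape.up ℕ)).obj E.cocomplex
  let d : ∀ n, E.cocomplex.X n →ₗ[R] E.cocomplex.X (n + 1) := fun n => (E.cocomplex.d n (n + 1)).hom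
  have hd : ∀ n, d (n + 1) ∘ₗ d n = 0 := fun n =>
    congrArg ModuleCat.Hom.hom (E.complex_d_comp n)
  have hexact : ∀ n, LinearMap.ker (d (n + 1)) ≤ LinearMap.range (d n) := fun n =>
    (ShortComplex.moduleCat_exact_iff_ker_sub_range _).1 (E.exact_succ n)
  have hinj : ∀ n, Module.Injective R (E.cocomplex.X n) := fun n =>
    have : Injective (ModuleCat.of R (E.cocomplex.X n)) := E.injective n
    Module.injective_module_of_injective_object R (E.cocomplex.X n)
  have hinjG : ∀ n, Module.Injective R (torsion I J (E.cocomplex.X n)) := fun n =>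
    injective_torsion I J _
  have h0 : IsNoetherian R (LinearMap.ker (d 0)) := by
    have hker : LinearMap.ker (d 0) ≤ LinearMap.range (E.ι.f 0).hom :=
      (ShortComplex.moduleCat_exact_iff_ker_sub_range _).1 E.exact₀
    have hM : IsNoetherian R
        (((CochainComplex.single₀ (ModuleCat.{u} R)).obj (ModuleCat.of R M)).X 0) :=
      inferInstanceAs (IsNoetherian R M)
    have : IsNoetherian R (LinearMap.range (E.ι.f 0).hom) :=
      isNoetherian_of_surjective (LinearMap.rangeRestrict (E.ι.f 0).hom)
        (LinearMap.range_rangeRestrict _)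
    exact isNoetherian_of_le hker
  have hG : ∀ n, ∀ y ∈ torsion I J (E.cocomplex.X n), d n y ∈ torsion I J (E.cocomplex.X (n + 1)) :=
    fun n y hy => map_mem_torsion I J (d n) hy
  have e : ∀ n, Nonempty (localCohomology I J n M ≃ₗ[R]
      cohomology (fun n => (d n).restrict (hG n)) n) := fun n => by
    obtain ⟨f⟩ := nonempty_homology_linearEquiv K n
    exact ⟨(E.isoRightDerivedObj (torsionFunctor I J) n).toLinearEquiv.trans f⟩
  have key := isNoetherian_torsionBySet_cohomology I d hd hexact
    (fun n => torsion I J (E.cocomplex.X n)) hG (fun n => torsionBySet_le_torsion I J _) i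
    (fun j hj k => by
      obtain ⟨f⟩ := e j
      exact finite_ext_of_linearEquiv _ f k ((h j hj).2 k))
  obtain ⟨f⟩ := e i
  exact isNoetherian_of_injective (torsionBySetMap I f.toLinearMap)
    fun a b hab => Subtype.ext (f.injective (congrArg Subtype.val hab))

theorem subsingleton_localCohomology_top [IsLocalRing R] (J : Ideal R) (hJ : J ≠ ⊤)
    (M : Type u) [AddCommGroup M] [Module R M] (i : ℕ) :
    Subsingleton (localCohomology ⊤ J i M) := by
  let E := InjectiveResolution.of (ModuleCat.of R M)
  let K := ((torsionFunctor ⊤ J).mapHomologicalComplex (ComplexShape.up ℕ)).obj E.cocomplex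
  obtain ⟨f⟩ := nonempty_homology_linearEquiv K i
  have : Subsingleton (K.X i) := by
    change Subsingleton (torsion ⊤ J (E.cocomplex.X i))
    rw [torsion_top_left J hJ]
    infer_instance
  exact ((E.isoRightDerivedObj (torsionFunctor ⊤ J) i).toLinearEquiv.trans f).toEquiv.subsingleton

end Main

end PairLocalCohomology

theorem theorem3p1 {R : Type u} [CommRing R] [IsNoetherianRing R] [IsLocalRing R]
    (I J : Ideal R) (hIJ : ¬ (I = ⊤ ∧ J = ⊤))
    (M : Type u) [AddCommGroup M] [Module R M] [Module.Finite R M]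
    (t : ℕ) (ht : 1 ≤ t)
    (hsupp : ∀ i < t, Module.support R (PairLocalCohomology.localCohomology I J i M) ⊆
      {IsLocalRing.closedPoint R}) :
    ∀ i < t, IsArtinian R (PairLocalCohomology.localCohomology I J i M) ∧
      PairLocalCohomology.IsCofinite I (PairLocalCohomology.localCohomology I J i M) := by
  intro i
  induction i using Nat.strong_induction_on with
  | _ i ih =>
    intro hi
    have hnoeth : IsNoetherian R
        (Submodule.torsionBySet R (PairLocalCohomology.localCohomology I J i M) I) :=
      PairLocalCohomology.isNoetherian_torsionBySet_localCohomology I J M i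
        fun j hj => (ih j hj (hj.trans hi)).2
    -- If `I = R` then `J ≠ R` and `Γ_{I,J} = 0`; otherwise `I` lies in the maximal ideal.
    obtain rfl | hI := eq_or_ne I ⊤
    · have := PairLocalCohomology.subsingleton_localCohomology_top J (fun hJ => hIJ ⟨rfl, hJ⟩) M i
      have hart : IsArtinian R (PairLocalCohomology.localCohomology ⊤ J i M) := inferInstance
      refine ⟨hart, ?_, fun j => PairLocalCohomology.finite_ext_of_isArtinian _ _ j⟩
      rw [Module.support_eq_empty]
      exact Set.empty_subset _
    · have hart := PairLocalCohomology.isArtinian_of_isNoetherian_torsionBySet I hI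
        (PairLocalCohomology.localCohomology I J i M) (hsupp i hi)
      refine ⟨hart, fun p hp => ?_, fun j => PairLocalCohomology.finite_ext_of_isArtinian _ _ j⟩
      rw [hsupp i hi hp]
      exact IsLocalRing.le_maximalIdeal hI
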